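/- Let $\mathbb{R}^d$ be endowed with an arbitrary fixed norm $|\cdot|$ and let $a<b$. For a point $x\in\mathbb{R}^d$ and nonempty compact sets $A,B\subset\mathbb{R}^d$ let $\Pi_B(x)=\{y\in B: |x-y|=\operatorname{dist}(x,B)\}$, and call $(u,v)\in A\times B$ a metric pair of $(A,B)$ if $u\in\Pi_A(v)$ or $v\in\Pi_B(u)$. Let $F$ be a set-valued function from $[a,b]$ to the nonempty compact subsets of $\mathbb{R}^d$ that has bounded variation with respect to the Hausdorff metric and whose graph $\{(x,y): x\in[a,b],\ y\in F(x)\}$ is compact. For a partition $\chi=\{a=x_0<\dots<x_n=b\}$, $n\ge 1$, with norm $|\chi|=\max_i(x_{i+1}-x_i)$, and points $y_0,\dots,y_n$ such that $(y_i,y_{i+1})$ is a metric pair of $(F(x_i),F(x_{i+1}))$ for $i=0,\dots,n-1$, the corresponding chain function is the function on $[a,b]$ that equals $y_i$ on $[x_i,x_{i+1})$ for $0\le i\le n-1$ and $y_n$ at $x_n=b$. A metric selection of $F$ is a function $s:[a,b]\to\mathbb{R}^d$ with $s(x)\in F(x)$ for all $x\in[a,b]$ that is the pointwise limit on $[a,b]$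 of a sequence of chain functions of $F$ whose partitions $\chi_k$ satisfy $|\chi_k|\to 0$. Let $\mathcal{S}(F)$ be the set of all metric selections of $F$. Then: (i) $\mathcal{S}(F)$ is contained in $L^1[a,b]$ (the space of integrable functions $[a,b]\to\mathbb{R}^d$ with the norm $\|f\|_{L^1}=\int_a^b|f(x)|\,dx$) and is compact in it. (ii) Let $\mathcal{K}_n:[a,b]\times[a,b]\to\mathbb{R}$, $n\in\mathbb{N}$, be kernels and let $T_nf(x)=\int_a^b\mathcal{K}_n(x,t)f(t)\,dt$, $x\in[a,b]$ (componentwise). For every $n$ for which $\mathcal{K}_n$ is continuous on $[a,b]^2$, the set $T_n\mathcal{S}(F)=\{T_ns: s\in\mathcal{S}(F)\}$ is contained in $L^1[a,b]$ and is compact in it. -/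

import Mathlib

open MeasureTheory Filter Topology TopologicalSpace

noncomputable section

/-- The set of projections of the point `x` on the nonempty compact set `B`. -/
def metricProj {E : Type*} [NormedAddCommGroup E] (x : E) (B : NonemptyCompacts E) : Set E :=
  {b | b ∈ B ∧ ‖x - b‖ = Metric.infDist x (B : Set E)}

/-- The set of metric pairs of two nonempty compact sets. -/
def metricPairs {E : Type*} [NormedAddCommGroup E] (A B : NonemptyCompacts E) : Set (E × E) :=
  {p | p.1 ∈ A ∧ p.2 ∈ B ∧ (p.1 ∈ metricProj p.2 A ∨ p.2 ∈ metricProj p.1 B)}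

/-- The metric chains of a finite sequence `A 0, …, A n` of nonempty compact sets. -/
def metricChains {E : Type*} [NormedAddCommGroup E] {n : ℕ}
    (A : Fin (n + 1) → NonemptyCompacts E) : Set (Fin (n + 1) → E) :=
  {y | ∀ i : Fin n, (y i.castSucc, y i.succ) ∈ metricPairs (A i.castSucc) (A i.succ)}

/-- A partition `a = x₀ < x₁ < ⋯ < xₙ = b`, `n ≥ 1`, of the interval `[a, b]`. -/
structure IntervalPartition (a b : ℝ) where
  /-- the number of subintervals -/
  n : ℕ
  one_le : 1 ≤ n
  /-- the partition points -/
  pts : Fin (n + 1) → Set.Icc a b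
  strictMono : StrictMono pts
  first : (pts 0 : ℝ) = a
  last : (pts (Fin.last n) : ℝ) = b

/-- The norm of a partition: the largest of the lengths of its (finitely many) subintervals. -/
def IntervalPartition.mesh {a b : ℝ} (χ : IntervalPartition a b) : ℝ :=
  ⨆ i : Fin χ.n, ((χ.pts i.succ : ℝ) - (χ.pts i.castSucc : ℝ))

/-- `c` is the chain function of the multifunction `F` based on the partition `χ` and on some
metric chain `y` of `F x₀, …, F xₙ`: it equals `y i` on `[xᵢ, xᵢ₊₁)` and `y n` at `xₙ`. -/
def IsChainFunction {E : Type*} [NormedAddCommGroup E] {a b : ℝ}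
    (F : Set.Icc a b → NonemptyCompacts E) (χ : IntervalPartition a b)
    (c : Set.Icc a b → E) : Prop :=
  ∃ y ∈ metricChains (fun i => F (χ.pts i)),
    (∀ (i : Fin χ.n), ∀ x ∈ Set.Ico (χ.pts i.castSucc) (χ.pts i.succ), c x = y i.castSucc) ∧
    c (χ.pts (Fin.last χ.n)) = y (Fin.last χ.n)

/-- The set of all metric selections of `F`: the selections of `F` that are pointwise limits of
chain functions of `F` whose partitions have norms tending to zero. -/
def metricSelections {E : Type*} [NormedAddCommGroup E] {a b : ℝ}
    (F : Set.Icc a b → NonemptyCompacts E) : Set (Set.Icc a b → E) :=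
  {s | (∀ x, s x ∈ F x) ∧
    ∃ (χ : ℕ → IntervalPartition a b) (c : ℕ → Set.Icc a b → E),
      (∀ k, IsChainFunction F (χ k) (c k)) ∧
      Tendsto (fun k => (χ k).mesh) atTop (𝓝 0) ∧
      ∀ x, Tendsto (fun k => c k x) atTop (𝓝 (s x))}

/-- The graph of a multifunction on `[a, b]`. -/
def multiGraph {E : Type*} [NormedAddCommGroup E] {a b : ℝ}
    (F : Set.Icc a b → NonemptyCompacts E) : Set (ℝ × E) :=
  {p | ∃ x : Set.Icc a b, p.1 = x ∧ p.2 ∈ F x}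

/-- The class of multifunctions on `[a, b]` that have a compact graph and are of bounded variation
with respect to the Hausdorff metric (which is the metric of `NonemptyCompacts E`). -/
def IsBVCompactGraph {E : Type*} [NormedAddCommGroup E] {a b : ℝ}
    (F : Set.Icc a b → NonemptyCompacts E) : Prop :=
  BoundedVariationOn F Set.univ ∧ IsCompact (multiGraph F)

/-- Lebesgue measure on `[a, b]`. -/
abbrev lebesgueIcc (a b : ℝ) : Measure (Set.Icc a b) :=
  Measure.comap Subtype.val (volume : Measure ℝ)

/-- The integral operator with kernel `K` on functions on `[a, b]`:
`(T f) x = ∫ₐᵇ K(x, t) f(t) dt`. -/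
def kernelOperator {E : Type*} [NormedAddCommGroup E] [NormedSpace ℝ E] {a b : ℝ}
    (K : Set.Icc a b × Set.Icc a b → ℝ) (f : Set.Icc a b → E) : Set.Icc a b → E :=
  fun x => ∫ t, K (x, t) • f t ∂(lebesgueIcc a b)

/-- A set `A` of functions on `[a, b]` is compact in `L¹[a, b]`: every member of `A` is in `L¹`, and
the set of the classes of the members of `A` is a compact subset of the normed space `L¹`. -/
def IsCompactInL1 {E : Type*} [NormedAddCommGroup E] {a b : ℝ}
    (A : Set (Set.Icc a b → E)) : Prop :=
  (∀ f ∈ A, MemLp f 1 (lebesgueIcc a b)) ∧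
  IsCompact {g : Lp E 1 (lebesgueIcc a b) | ∃ f ∈ A, g =ᵐ[lebesgueIcc a b] f}

end

/-! The points of a metric pair are no farther apart than the Hausdorff distance of the two sets.
Along a chain these bounds telescope, so increments of a chain function are controlled by those of
the variation function `v` of `F`, taken at nearby partition points. As `v` is monotone, it has
countably many discontinuities, and a Helly argument yields pointwise convergent subsequences when
the meshes tend to zero; closedness of the graph makes the limit a selection
(`exists_subseq_tendsto_metricSelection`). For (i), each member of a sequence of metric selections
is replaced by an `L¹`-close chain function of small mesh. A pointwise limit of a subsequence of
these is also an `L¹` limit by dominated convergence. For (ii), the operator is Lipschitz from `L¹`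
to continuous functions, which embed continuously in `L¹`. -/

/-- A selection principle of Helly type: functions with values in a compact set whose increments
are asymptotically controlled by a function with countably many discontinuities have a pointwise
convergent subsequence. -/
theorem exists_subseq_tendsto_of_dist_le {X Y : Type*} [TopologicalSpace X] [SeparableSpace X]
    [MetricSpace Y] {v : X → ℝ} (hv : {x | ¬ContinuousAt v x}.Countable) {C : Set Y}
    (hC : IsCompact C) {c : ℕ → X → Y} (hc : ∀ n x, c n x ∈ C) {p : ℕ → X → X}
    (hp : ∀ x, Tendsto (fun n => p n x) atTop (𝓝 x))
    (h : ∀ n x y, dist (c n x) (c n y) ≤ |v (p n x) - v (p n y)|) :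
    ∃ φ : ℕ → ℕ, StrictMono φ ∧ ∃ s : X → Y,
      ∀ x, Tendsto (fun k => c (φ k) x) atTop (𝓝 (s x)) := by
  obtain ⟨D₀, hD₀c, hD₀⟩ := exists_countable_dense X
  -- A diagonal argument settles convergence on this countable set; off it `v` is continuous.
  let D : Set X := D₀ ∪ {x | ¬ContinuousAt v x}
  have hDc : D.Countable := hD₀c.union hv
  have : Countable D := hDc.to_subtype
  have hpi : IsCompact {f : D → Y | ∀ i, f i ∈ C} := isCompact_pi_infinite fun _ => hC
  obtain ⟨t, -, φ, hφ, ht⟩ := hpi.isSeqCompact (x := fun n (i : D) => c n i) fun n i => hc n i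
  rw [tendsto_pi_nhds] at ht
  refine ⟨φ, hφ, ?_⟩
  suffices H : ∀ x, ∃ l, Tendsto (fun k => c (φ k) x) atTop (𝓝 l) by
    choose s hs using H
    exact ⟨s, hs⟩
  intro x
  by_cases hx : x ∈ D
  · exact ⟨t ⟨x, hx⟩, ht ⟨x, hx⟩⟩
  have hxv : ContinuousAt v x := by
    by_contra hcon
    exact hx (Or.inr hcon)
  have hcau : CauchySeq (fun k => c (φ k) x) := by
    rw [Metric.cauchySeq_iff']
    intro ε hε
    have hU : {z | |v z - v x| < ε / 8} ∈ 𝓝 x := by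
      have := Metric.tendsto_nhds.1 hxv (ε / 8) (by positivity)
      exact this
    obtain ⟨U, hUs, hUo, hxU⟩ := mem_nhds_iff.1 hU
    obtain ⟨y, hyU, hyD⟩ := hD₀.inter_open_nonempty U hUo ⟨x, hxU⟩
    have h1 := hφ.tendsto_atTop.eventually ((hp x).eventually (hUo.mem_nhds hxU))
    have h2 := hφ.tendsto_atTop.eventually ((hp y).eventually (hUo.mem_nhds hyU))
    have h3 := Metric.tendsto_nhds.1 (ht ⟨y, Or.inl hyD⟩) (ε / 8) (by positivity)
    obtain ⟨N, hN⟩ := eventually_atTop.1 (h1.and (h2.and h3))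
    -- The limit at the nearby point `y` serves as a common reference: 2ε/8 from the oscillation of
    -- `v` on `U`, ε/8 from convergence at `y`.
    have key : ∀ n ≥ N, dist (c (φ n) x) (t ⟨y, Or.inl hyD⟩) < 3 * ε / 8 := by
      intro n hn
      obtain ⟨a1, a2, a3⟩ := hN n hn
      have b1 := abs_lt.1 (show |v (p (φ n) x) - v x| < ε / 8 from hUs a1)
      have b2 := abs_lt.1 (show |v (p (φ n) y) - v x| < ε / 8 from hUs a2)
      have b3 : |v (p (φ n) x) - v (p (φ n) y)| < 2 * ε / 8 := by
        rw [abs_lt]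
        constructor <;> linarith [b1.1, b1.2, b2.1, b2.2]
      have b4 := h (φ n) x y
      have b5 := dist_triangle (c (φ n) x) (c (φ n) y) (t ⟨y, Or.inl hyD⟩)
      have b6 : dist (c (φ n) y) (t ⟨y, Or.inl hyD⟩) < ε / 8 := a3
      linarith
    refine ⟨N, fun n hn => ?_⟩
    have := dist_triangle_right (c (φ n) x) (c (φ N) x) (t ⟨y, Or.inl hyD⟩)
    linarith [key n hn, key N le_rfl]
  obtain ⟨l, -, hl⟩ := cauchySeq_tendsto_of_isComplete hC.isComplete (fun k => hc (φ k) x) hcau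
  exact ⟨l, hl⟩

/-! ### Metric chains, partitions and chain functions -/

section Chains

variable {E : Type*} [NormedAddCommGroup E]

theorem dist_le_of_mem_metricPairs {A B : NonemptyCompacts E} {p : E × E}
    (hp : p ∈ metricPairs A B) : dist p.1 p.2 ≤ dist A B := by
  have hfin : Metric.hausdorffEDist (A : Set E) B ≠ ⊤ := edist_ne_top A B
  obtain ⟨h1, h2, h | h⟩ := hp
  · rw [dist_comm p.1, dist_comm A, dist_eq_norm, h.2, Metric.NonemptyCompacts.dist_eq]
    exact Metric.infDist_le_hausdorffDist_of_mem h2 (by rwa [Metric.hausdorffEDist_comm])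
  · rw [dist_eq_norm, h.2, Metric.NonemptyCompacts.dist_eq]
    exact Metric.infDist_le_hausdorffDist_of_mem h1 hfin

theorem metricChains_mem {n : ℕ} (hn : 1 ≤ n) {A : Fin (n + 1) → NonemptyCompacts E}
    {y : Fin (n + 1) → E} (hy : y ∈ metricChains A) (i : Fin (n + 1)) : y i ∈ A i := by
  induction i using Fin.cases with
  -- Membership is read off from pairs, so index 0 needs at least one subinterval.
  | zero => exact (hy ⟨0, hn⟩).1
  | succ i => exact (hy i).2.1

theorem metricChains_dist_le {n : ℕ} {A : Fin (n + 1) → NonemptyCompacts E}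
    {y : Fin (n + 1) → E} (hy : y ∈ metricChains A) {w : Fin (n + 1) → ℝ}
    (hw : ∀ i : Fin n, dist (A i.castSucc) (A i.succ) ≤ w i.succ - w i.castSucc)
    (i j : Fin (n + 1)) : dist (y i) (y j) ≤ |w i - w j| := by
  have H : ∀ j i : Fin (n + 1), i ≤ j → dist (y i) (y j) ≤ w j - w i := by
    intro j
    induction j using Fin.induction with
    | zero =>
      intro i hi
      obtain rfl : i = 0 := Fin.le_zero_iff.1 hi
      simp
    | succ j ih =>
      intro i hi
      rcases hi.eq_or_lt with rfl | hlt
      · simp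
      · have h1 := ih i (Fin.le_castSucc_iff.2 hlt)
        have h2 := (dist_le_of_mem_metricPairs (hy j)).trans (hw j)
        have h3 := dist_triangle (y i) (y j.castSucc) (y j.succ)
        dsimp only at h2
        linarith
  rcases le_total i j with hij | hij
  · rw [abs_sub_comm]
    exact (H j i hij).trans (le_abs_self _)
  · rw [dist_comm]
    exact (H i j hij).trans (le_abs_self _)

variable {a b : ℝ}

theorem IntervalPartition.le_mesh (χ : IntervalPartition a b) (i : Fin χ.n) :
    (χ.pts i.succ : ℝ) - χ.pts i.castSucc ≤ χ.mesh :=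
  le_ciSup (f := fun i : Fin χ.n => (χ.pts i.succ : ℝ) - χ.pts i.castSucc)
    (Set.finite_range _).bddAbove i

theorem IntervalPartition.mesh_nonneg (χ : IntervalPartition a b) : 0 ≤ χ.mesh :=
  Real.iSup_nonneg fun i => sub_nonneg.2 (χ.strictMono.monotone i.castSucc_le_succ)

theorem IntervalPartition.exists_index (χ : IntervalPartition a b) (x : Set.Icc a b) :
    ∃ i, χ.pts i ≤ x ∧ ∀ j, χ.pts j ≤ x → j ≤ i := by
  obtain ⟨i, hi, hmax⟩ := (Set.toFinite {i | χ.pts i ≤ x}).exists_maximal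
    ⟨0, by
      change (χ.pts 0 : ℝ) ≤ x
      rw [χ.first]
      exact x.2.1⟩
  refine ⟨i, hi, fun j hj => ?_⟩
  rcases le_total j i with h | h
  · exact h
  · exact hmax hj h

/-- The index of the last partition point that is not to the right of `x`. -/
noncomputable def IntervalPartition.index (χ : IntervalPartition a b) (x : Set.Icc a b) :
    Fin (χ.n + 1) :=
  (χ.exists_index x).choose

theorem IntervalPartition.pts_index_le (χ : IntervalPartition a b) (x : Set.Icc a b) :
    χ.pts (χ.index x) ≤ x :=
  (χ.exists_index x).choose_spec.1

theorem IntervalPartition.le_index (χ : IntervalPartition a b) {x : Set.Icc a b}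
    {j : Fin (χ.n + 1)} (h : χ.pts j ≤ x) : j ≤ χ.index x :=
  (χ.exists_index x).choose_spec.2 j h

theorem IntervalPartition.index_mono (χ : IntervalPartition a b) : Monotone χ.index :=
  fun x _ hxy => χ.le_index ((χ.pts_index_le x).trans hxy)

theorem IntervalPartition.lt_pts_succ (χ : IntervalPartition a b) {x : Set.Icc a b}
    {i : Fin χ.n} (h : χ.index x = i.castSucc) : x < χ.pts i.succ := by
  by_contra! hcon
  have := χ.le_index hcon
  rw [h] at this
  exact absurd this (not_le.2 i.castSucc_lt_succ)

theorem IntervalPartition.eq_pts_last (χ : IntervalPartition a b) {x : Set.Icc a b}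
    (h : χ.index x = Fin.last χ.n) : x = χ.pts (Fin.last χ.n) := by
  refine le_antisymm ?_ (h ▸ χ.pts_index_le x)
  change (x : ℝ) ≤ χ.pts (Fin.last χ.n)
  rw [χ.last]
  exact x.2.2

theorem IntervalPartition.dist_pts_index_le (χ : IntervalPartition a b) (x : Set.Icc a b) :
    dist (χ.pts (χ.index x)) x ≤ χ.mesh := by
  have h0 : (χ.pts (χ.index x) : ℝ) ≤ x := χ.pts_index_le x
  rw [Subtype.dist_eq, dist_comm, Real.dist_eq, abs_of_nonneg (sub_nonneg.2 h0)]
  rcases Fin.eq_castSucc_or_eq_last (χ.index x) with ⟨i, hi⟩ | hi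
  · have h1 : (x : ℝ) < χ.pts i.succ := χ.lt_pts_succ hi
    have h2 := χ.le_mesh i
    rw [hi]
    linarith
  · rw [hi, ← χ.eq_pts_last hi, sub_self]
    exact χ.mesh_nonneg

theorem IsChainFunction.exists_eq_comp_index {F : Set.Icc a b → NonemptyCompacts E}
    {χ : IntervalPartition a b} {c : Set.Icc a b → E} (hc : IsChainFunction F χ c) :
    ∃ y ∈ metricChains (fun i => F (χ.pts i)), ∀ x, c x = y (χ.index x) := by
  obtain ⟨y, hy, h1, h2⟩ := hc
  refine ⟨y, hy, fun x => ?_⟩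
  rcases Fin.eq_castSucc_or_eq_last (χ.index x) with ⟨i, hi⟩ | hi
  · rw [hi]
    exact h1 i x ⟨hi ▸ χ.pts_index_le x, χ.lt_pts_succ hi⟩
  · rw [hi, ← h2, ← χ.eq_pts_last hi]

theorem IsChainFunction.mem {F : Set.Icc a b → NonemptyCompacts E}
    {χ : IntervalPartition a b} {c : Set.Icc a b → E} (hc : IsChainFunction F χ c)
    (x : Set.Icc a b) : c x ∈ F (χ.pts (χ.index x)) := by
  obtain ⟨y, hy, h⟩ := hc.exists_eq_comp_index
  rw [h]
  exact metricChains_mem χ.one_le hy _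

theorem IsChainFunction.dist_le {F : Set.Icc a b → NonemptyCompacts E}
    {χ : IntervalPartition a b} {c : Set.Icc a b → E} (hc : IsChainFunction F χ c)
    {v : Set.Icc a b → ℝ} (hv : ∀ x y, x ≤ y → dist (F x) (F y) ≤ v y - v x)
    (x y : Set.Icc a b) :
    dist (c x) (c y) ≤ |v (χ.pts (χ.index x)) - v (χ.pts (χ.index y))| := by
  obtain ⟨z, hz, h⟩ := hc.exists_eq_comp_index
  rw [h, h]
  exact metricChains_dist_le hz (w := fun i => v (χ.pts i))
    (fun i => hv _ _ (χ.strictMono.monotone i.castSucc_le_succ)) _ _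

theorem IsChainFunction.stronglyMeasurable {F : Set.Icc a b → NonemptyCompacts E}
    {χ : IntervalPartition a b} {c : Set.Icc a b → E} (hc : IsChainFunction F χ c) :
    StronglyMeasurable c := by
  obtain ⟨y, -, h⟩ := hc.exists_eq_comp_index
  obtain rfl : c = y ∘ χ.index := funext h
  exact StronglyMeasurable.of_discrete.comp_measurable χ.index_mono.measurable

theorem tendsto_pts_index {χ : ℕ → IntervalPartition a b}
    (hχ : Tendsto (fun k => (χ k).mesh) atTop (𝓝 0)) (x : Set.Icc a b) :
    Tendsto (fun k => (χ k).pts ((χ k).index x)) atTop (𝓝 x) :=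
  tendsto_iff_dist_tendsto_zero.2 <|
    squeeze_zero (fun _ => dist_nonneg) (fun k => (χ k).dist_pts_index_le x) hχ

/-- The variation of `F` from `a` to the current point serves as `v`. -/
theorem IsBVCompactGraph.exists_monotone (hab : a ≤ b) {F : Set.Icc a b → NonemptyCompacts E}
    (hF : IsBVCompactGraph F) :
    ∃ v : Set.Icc a b → ℝ, Monotone v ∧ ∀ x y, x ≤ y → dist (F x) (F y) ≤ v y - v x := by
  have hl := hF.1.locallyBoundedVariationOn
  refine ⟨variationOnFromTo F Set.univ ⟨a, le_rfl, hab⟩, ?_, fun x y hxy => ?_⟩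
  · exact monotoneOn_univ.1 (variationOnFromTo.monotoneOn hl (Set.mem_univ _))
  · have := variationOnFromTo.add hl (Set.mem_univ (⟨a, le_rfl, hab⟩ : Set.Icc a b))
      (Set.mem_univ x) (Set.mem_univ y)
    rw [← this, add_sub_cancel_left, variationOnFromTo.eq_of_le F Set.univ hxy, dist_edist]
    exact ENNReal.toReal_mono (hl x y (Set.mem_univ _) (Set.mem_univ _))
      (eVariationOn.edist_le F ⟨Set.mem_univ _, le_rfl, hxy⟩ ⟨Set.mem_univ _, hxy, le_rfl⟩)

theorem IsBVCompactGraph.exists_isCompact {F : Set.Icc a b → NonemptyCompacts E}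
    (hF : IsBVCompactGraph F) : ∃ C : Set E, IsCompact C ∧ ∀ x, ∀ y ∈ F x, y ∈ C :=
  ⟨Prod.snd '' multiGraph F, hF.2.image continuous_snd, fun x y hy => ⟨(x, y), ⟨x, rfl, hy⟩, rfl⟩⟩

theorem IsBVCompactGraph.mem_of_tendsto {F : Set.Icc a b → NonemptyCompacts E}
    (hF : IsBVCompactGraph F) {x : ℕ → Set.Icc a b} {x₀ : Set.Icc a b} {y : ℕ → E} {y₀ : E}
    (hx : Tendsto x atTop (𝓝 x₀)) (hy : Tendsto y atTop (𝓝 y₀)) (h : ∀ k, y k ∈ F (x k)) :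
    y₀ ∈ F x₀ := by
  have ht : Tendsto (fun k => ((x k : ℝ), y k)) atTop (𝓝 ((x₀ : ℝ), y₀)) :=
    ((continuous_subtype_val.tendsto x₀).comp hx).prodMk_nhds hy
  obtain ⟨z, hz, hz'⟩ := hF.2.isClosed.mem_of_tendsto ht
    (Eventually.of_forall fun k => ⟨x k, rfl, h k⟩)
  rwa [Subtype.ext hz]

/-- Chain functions of a multifunction of bounded variation with compact graph, on partitions with
norms tending to zero, have a subsequence converging pointwise to a metric selection. -/
theorem exists_subseq_tendsto_metricSelection (hab : a ≤ b) {F : Set.Icc a b → NonemptyCompacts E}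
    (hF : IsBVCompactGraph F) {χ : ℕ → IntervalPartition a b} {c : ℕ → Set.Icc a b → E}
    (hc : ∀ k, IsChainFunction F (χ k) (c k))
    (hχ : Tendsto (fun k => (χ k).mesh) atTop (𝓝 0)) :
    ∃ φ : ℕ → ℕ, StrictMono φ ∧ ∃ s ∈ metricSelections F,
      ∀ x, Tendsto (fun k => c (φ k) x) atTop (𝓝 (s x)) := by
  obtain ⟨v, hv, hFv⟩ := hF.exists_monotone hab
  obtain ⟨C, hC, hFC⟩ := hF.exists_isCompact
  obtain ⟨φ, hφ, s, hs⟩ := exists_subseq_tendsto_of_dist_le hv.countable_not_continuousAt hC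
    (fun n x => hFC _ _ ((hc n).mem x)) (tendsto_pts_index hχ) (fun n => (hc n).dist_le hFv)
  refine ⟨φ, hφ, s, ⟨fun x => ?_, χ ∘ φ, c ∘ φ, fun k => hc _, hχ.comp hφ.tendsto_atTop, hs⟩, hs⟩
  exact hF.mem_of_tendsto ((tendsto_pts_index hχ x).comp hφ.tendsto_atTop) (hs x)
    fun k => (hc (φ k)).mem x

end Chains

/-! ### Compactness in L¹ -/

section Lebesgue

variable {E : Type*} [NormedAddCommGroup E] {a b : ℝ}

instance isFiniteMeasure_lebesgueIcc : IsFiniteMeasure (lebesgueIcc a b) := by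
  constructor
  rw [(MeasurableEmbedding.subtype_coe measurableSet_Icc).comap_apply, Set.image_univ,
    Subtype.range_coe]
  exact measure_Icc_lt_top

theorem tendsto_eLpNorm_one_sub_of_bounded {α : Type*} [MeasurableSpace α] {μ : Measure α}
    [IsFiniteMeasure μ] {f : ℕ → α → E} {g : α → E} {M : ℝ}
    (hf : ∀ n, AEStronglyMeasurable (f n) μ) (hM : ∀ n x, ‖f n x‖ ≤ M)
    (hfg : ∀ x, Tendsto (fun n => f n x) atTop (𝓝 (g x))) :
    Tendsto (fun n => eLpNorm (f n - g) 1 μ) atTop (𝓝 0) := by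
  have := tendsto_lintegral_norm_of_dominated_convergence hf
    (integrable_const M : Integrable (fun _ : α => M) μ).hasFiniteIntegral
    (fun n => Eventually.of_forall (hM n)) (Eventually.of_forall hfg)
  refine this.congr fun n => ?_
  rw [eLpNorm_one_eq_lintegral_enorm]
  simp only [ofReal_norm, Pi.sub_apply]

theorem metricSelections_memLp {F : Set.Icc a b → NonemptyCompacts E} (hF : IsBVCompactGraph F)
    {s : Set.Icc a b → E} (hs : s ∈ metricSelections F) : MemLp s 1 (lebesgueIcc a b) := by
  obtain ⟨hsF, χ, c, hc, -, hcs⟩ := hs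
  obtain ⟨C, hC, hFC⟩ := hF.exists_isCompact
  obtain ⟨M, hM⟩ := hC.isBounded.exists_norm_le
  have hm : StronglyMeasurable s := stronglyMeasurable_of_tendsto atTop
    (fun k => (hc k).stronglyMeasurable) (tendsto_pi_nhds.2 hcs)
  exact MemLp.of_bound hm.aestronglyMeasurable M
    (Eventually.of_forall fun x => hM _ (hFC _ _ (hsF x)))

theorem isCompactInL1_metricSelections (hab : a ≤ b) {F : Set.Icc a b → NonemptyCompacts E}
    (hF : IsBVCompactGraph F) : IsCompactInL1 (metricSelections F) := by
  refine ⟨fun s hs => metricSelections_memLp hF hs, IsSeqCompact.isCompact fun g hg => ?_⟩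
  obtain ⟨C, hC, hFC⟩ := hF.exists_isCompact
  obtain ⟨M, hM⟩ := hC.isBounded.exists_norm_le
  choose s hs hgs using hg
  -- Pointwise convergence alone does not allow a diagonal choice uniform in `x`; the `L¹` distance
  -- is a single number that can be made small together with the mesh.
  have happrox : ∀ n : ℕ, ∃ (χ : IntervalPartition a b) (c : Set.Icc a b → E),
      IsChainFunction F χ c ∧ χ.mesh < 1 / ((n : ℝ) + 1) ∧
        eLpNorm (c - s n) 1 (lebesgueIcc a b) < ENNReal.ofReal (1 / ((n : ℝ) + 1)) := by
    intro n
    obtain ⟨-, χ, c, hc, hχ, hcs⟩ := hs n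
    have hpos : (0 : ℝ) < 1 / ((n : ℝ) + 1) := by positivity
    have h1 := tendsto_eLpNorm_one_sub_of_bounded (μ := lebesgueIcc a b)
      (fun k => (hc k).stronglyMeasurable.aestronglyMeasurable)
      (fun k x => hM _ (hFC _ _ ((hc k).mem x))) hcs
    obtain ⟨k, hk1, hk2⟩ := ((hχ.eventually (gt_mem_nhds hpos)).and
      (h1.eventually (gt_mem_nhds (ENNReal.ofReal_pos.2 hpos)))).exists
    exact ⟨χ k, c k, hc k, hk1, hk2⟩
  choose χ c hc hχ hcs using happrox
  have hχ0 : Tendsto (fun k => (χ k).mesh) atTop (𝓝 0) :=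
    squeeze_zero (fun k => (χ k).mesh_nonneg) (fun k => (hχ k).le)
      tendsto_one_div_add_atTop_nhds_zero_nat
  have hcs0 : Tendsto (fun k => eLpNorm (c k - s k) 1 (lebesgueIcc a b)) atTop (𝓝 0) := by
    refine tendsto_of_tendsto_of_tendsto_of_le_of_le tendsto_const_nhds ?_
      (fun _ => zero_le) (fun k => (hcs k).le)
    simpa using ENNReal.tendsto_ofReal tendsto_one_div_add_atTop_nhds_zero_nat
  obtain ⟨φ, hφ, t, ht, hct⟩ := exists_subseq_tendsto_metricSelection hab hF hc hχ0
  have htL := metricSelections_memLp hF ht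
  refine ⟨htL.toLp t, ⟨t, ht, htL.coeFn_toLp⟩, φ, hφ, ?_⟩
  rw [Lp.tendsto_Lp_iff_tendsto_eLpNorm']
  have hcm : ∀ k, AEStronglyMeasurable (c k) (lebesgueIcc a b) :=
    fun k => (hc k).stronglyMeasurable.aestronglyMeasurable
  have h1 : Tendsto (fun k => eLpNorm (c (φ k) - t) 1 (lebesgueIcc a b)) atTop (𝓝 0) :=
    tendsto_eLpNorm_one_sub_of_bounded (fun k => hcm _)
      (fun k x => hM _ (hFC _ _ ((hc (φ k)).mem x))) hct
  have h2 := (hcs0.comp hφ.tendsto_atTop).add h1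
  rw [add_zero] at h2
  refine tendsto_of_tendsto_of_tendsto_of_le_of_le tendsto_const_nhds h2
    (fun _ => zero_le) fun k => ?_
  have hsm := (metricSelections_memLp hF (hs (φ k))).1
  -- Pass through the chain function: both summands tend to zero in `L¹`.
  have e : (⇑((g ∘ φ) k) - ⇑(htL.toLp t) : Set.Icc a b → E) =ᵐ[lebesgueIcc a b]
      (s (φ k) - c (φ k)) + (c (φ k) - t) := by
    filter_upwards [hgs (φ k), htL.coeFn_toLp] with x hx1 hx2
    simp only [Pi.sub_apply, Pi.add_apply, Function.comp_apply, hx1, hx2]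
    abel
  rw [eLpNorm_congr_ae e]
  refine (eLpNorm_add_le (hsm.sub (hcm _)) ((hcm _).sub htL.1) le_rfl).trans ?_
  rw [eLpNorm_sub_comm]
  rfl

/-! ### Integral operators with continuous kernel -/

variable [NormedSpace ℝ E]

theorem kernelOperator_congr_ae (K : Set.Icc a b × Set.Icc a b → ℝ) {f g : Set.Icc a b → E}
    (h : f =ᵐ[lebesgueIcc a b] g) : kernelOperator K f = kernelOperator K g := by
  funext x
  refine integral_congr_ae ?_
  filter_upwards [h] with t ht
  simp only [ht]

theorem integrable_kernel_smul {K : Set.Icc a b × Set.Icc a b → ℝ} (hK : Continuous K)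
    {M : ℝ} (hM : ∀ z, ‖K z‖ ≤ M) {f : Set.Icc a b → E} (hf : Integrable f (lebesgueIcc a b))
    (x : Set.Icc a b) : Integrable (fun t => K (x, t) • f t) (lebesgueIcc a b) :=
  hf.bdd_smul M (hK.comp (Continuous.prodMk_right x)).aestronglyMeasurable
    (Eventually.of_forall fun t => hM (x, t))

theorem continuous_kernelOperator {K : Set.Icc a b × Set.Icc a b → ℝ} (hK : Continuous K)
    {M : ℝ} (hM : ∀ z, ‖K z‖ ≤ M) {f : Set.Icc a b → E} (hf : Integrable f (lebesgueIcc a b)) :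
    Continuous (kernelOperator K f) := by
  refine continuous_of_dominated (bound := fun t => M * ‖f t‖)
    (fun x => (integrable_kernel_smul hK hM hf x).1) (fun x => Eventually.of_forall fun t => ?_)
    (hf.norm.const_mul M) (Eventually.of_forall fun t => ?_)
  · rw [norm_smul]
    exact mul_le_mul_of_nonneg_right (hM _) (norm_nonneg _)
  · exact (hK.comp (Continuous.prodMk_left t)).smul continuous_const

theorem norm_kernelOperator_sub_le {K : Set.Icc a b × Set.Icc a b → ℝ} (hK : Continuous K)
    {M : ℝ} (hM : ∀ z, ‖K z‖ ≤ M) (f g : Lp E 1 (lebesgueIcc a b)) (x : Set.Icc a b) :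
    ‖kernelOperator K f x - kernelOperator K g x‖ ≤ M * ‖f - g‖ := by
  have hf := L1.integrable_coeFn f
  have hg := L1.integrable_coeFn g
  have hfg := L1.integrable_coeFn (f - g)
  unfold kernelOperator
  rw [← integral_sub (integrable_kernel_smul hK hM hf x) (integrable_kernel_smul hK hM hg x),
    L1.norm_eq_integral_norm, ← integral_const_mul]
  refine norm_integral_le_of_norm_le (hfg.norm.const_mul M) ?_
  filter_upwards [Lp.coeFn_sub f g] with t ht
  rw [ht, Pi.sub_apply, ← smul_sub, norm_smul]
  exact mul_le_mul_of_nonneg_right (hM _) (norm_nonneg _)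

theorem IsCompactInL1.image_kernelOperator {A : Set (Set.Icc a b → E)} (hA : IsCompactInL1 A)
    {K : Set.Icc a b × Set.Icc a b → ℝ} (hK : Continuous K) :
    IsCompactInL1 ((fun s => kernelOperator K s) '' A) := by
  obtain ⟨M, hM'⟩ := (isCompact_range hK).isBounded.exists_norm_le
  have hM : ∀ z, ‖K z‖ ≤ M := fun z => hM' _ ⟨z, rfl⟩
  let T : Lp E 1 (lebesgueIcc a b) → C(Set.Icc a b, E) := fun f =>
    ⟨kernelOperator K f, continuous_kernelOperator hK hM (L1.integrable_coeFn f)⟩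
  have hT : Continuous T := by
    -- `M` may be negative if `[a, b]` is empty, hence the truncation.
    refine (LipschitzWith.of_dist_le_mul (K := M.toNNReal) fun f g => ?_).continuous
    rw [ContinuousMap.dist_le (by positivity)]
    intro x
    rw [dist_eq_norm, dist_eq_norm]
    exact (norm_kernelOperator_sub_le hK hM f g x).trans
      (mul_le_mul_of_nonneg_right (Real.le_coe_toNNReal M) (norm_nonneg _))
  let L := ContinuousMap.toLp (E := E) 1 (lebesgueIcc a b) ℝ
  have hL : ∀ f, L f =ᵐ[lebesgueIcc a b] f := fun f =>
    ContinuousMap.coeFn_toLp (E := E) (p := 1) (𝕜 := ℝ) (lebesgueIcc a b) f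
  have hTs : ∀ s (hs : MemLp s 1 (lebesgueIcc a b)), (T (hs.toLp s) : Set.Icc a b → E) =
      kernelOperator K s := fun s hs => kernelOperator_congr_ae K hs.coeFn_toLp
  refine ⟨?_, ?_⟩
  · rintro _ ⟨s, hs, rfl⟩
    have hsL := hA.1 s hs
    have := (Lp.memLp (L (T (hsL.toLp s)))).ae_eq (hL _)
    rwa [hTs s hsL] at this
  -- The operator ignores null sets, so classes of images are images of classes.
  · convert hA.2.image (L.continuous.comp hT) using 1
    ext g
    constructor
    · rintro ⟨_, ⟨s, hs, rfl⟩, hg⟩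
      have hsL := hA.1 s hs
      refine ⟨hsL.toLp s, ⟨s, hs, hsL.coeFn_toLp⟩, Lp.ext ?_⟩
      refine (hL _).trans ?_
      rw [hTs s hsL]
      exact hg.symm
    · rintro ⟨f, ⟨s, hs, hf⟩, rfl⟩
      refine ⟨_, ⟨s, hs, rfl⟩, (hL _).trans ?_⟩
      change kernelOperator K f =ᵐ[_] kernelOperator K s
      rw [kernelOperator_congr_ae K hf]

end Lebesgue

theorem mainTheorem12 {E : Type*} [NormedAddCommGroup E] [NormedSpace ℝ E] [FiniteDimensional ℝ E]
    {a b : ℝ} (hab : a < b)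
    (F : Set.Icc a b → NonemptyCompacts E) (hF : IsBVCompactGraph F)
    (K : ℕ → Set.Icc a b × Set.Icc a b → ℝ) :
    IsCompactInL1 (metricSelections F) ∧
    ∀ n : ℕ, Continuous (K n) →
      IsCompactInL1 ((fun s => kernelOperator (K n) s) '' metricSelections F) := by
  have h := isCompactInL1_metricSelections hab.le hF
  exact ⟨h, fun n hn => h.image_kernelOperator hn⟩
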